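/- Let $n\ge 1$ and $[n]=\{1,\dots,n\}$. A doubly rooted tree on a finite set $S$ is a tree with vertex set $S$ together with two distinguished, not necessarily distinct, vertices $r_1,r_2$ (its first and second root); on $S=\emptyset$ there is exactly one doubly rooted tree, the empty one. A triply rooted tree on $[n]$ is a tree with vertex set $[n]$ together with three distinguished, not necessarily distinct, vertices $r_1,r_2,r_3$. Let $T_n$ be the set of triply rooted trees on $[n]$, and let $Q_n$ be the set of triples $(D,D',D'')$ of doubly rooted trees, with $D$ nonempty and $D',D''$ possibly empty, whose vertex sets are pairwise disjoint with union $[n]$. For a triply rooted tree, ancestors, children and depths are taken with respect to the first root; every vertex is an ancestor and a descendant of itself, and the least common ancestor of two vertices is their common ancestor of largest depth. There is a bijection $\varphi\colon Q_n\to T_n$ with the following description. (i) The tree of $\varphi(D,D',D'')$ has as edges all the edges of $D,D',D''$, the edge $\{r_2(D),r_1(D')\}$ if $D'\ne\emptyset$, and the edge $\{r_2(D),r_1(D'')\}$ if $D''\neq\emptyset$. Its first root is $r_1(D)$; its second root is $r_2(D')$ if $D'\ne\emptyset$ and $r_2(D)$ otherwise; its third root is $r_2(D'')$ if $D''\neq\emptyset$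 and $r_2(D)$ otherwise. (ii) Conversely, let $T\in T_n$ have roots $r_1,r_2,r_3$. Then $r_2$ and $r_3$ have a unique least common ancestor $w$, and $(D,D',D'')=\varphi^{-1}(T)$ is obtained as follows. If $w\neq r_2$, let $x$ be the child of $w$ that is an ancestor of $r_2$; if $w\ne r_3$, let $y$ be the child of $w$ that is an ancestor of $r_3$. Remove from $T$ those of the edges $\{w,x\}$, $\{w,y\}$ that are defined. Then $D$ is the component containing $r_1$, with roots $r_1,w$; $D'$ is empty if $w=r_2$, and otherwise is the component containing $x$, with roots $x,r_2$; $D''$ is empty if $w=r_3$, and otherwise is the component containing $y$, with roots $y,r_3$. Moreover, with the convention $0^0=1$, put $$S_n=\sum_{j=1}^n\sum_{k=0}^{n-j}\binom nj\binom{n-j}k j^jk^k(n-j-k)^{n-j-k},$$ $$\xi(n)=\sum_{k=0}^n\binom nk\Bigl(\frac kn\Bigr)^k\Bigl(1-\frac kn\Bigr)^{n-k},\qquad \xi_2(n)=\sum_{j=0}^n\sum_{k=0}^{n-j}\binom nj\binom{n-j}k\Bigl(\frac jn\Bigr)^j\Bigl(\frac kn\Bigr)^k\Bigl(1-\frac jn-\frac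 kn\Bigr)^{n-j-k}.$$ Then $|Q_n|=S_n$ and $|T_n|=n^{n+1}$, and hence $S_n=n^{n+1}$. Since $n^n\bigl(\xi_2(n)-\xi(n)\bigr)=S_n$, this identity is equivalent to Lacasse's identity $\xi_2(n)=\xi(n)+n$, which therefore holds as well. -/

import Mathlib

namespace TriplyRooted

/-- A (nonempty) doubly rooted tree whose vertex set is a subset of `V`: a subgraph of the complete
graph on `V`, i.e. a graph on a subset of `V`, that is a tree, with two distinguished vertices,
not necessarily distinct. -/
@[ext]
structure DoublyRootedTree (V : Type*) where
  tree : (⊤ : SimpleGraph V).Subgraph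
  isTree : tree.coe.IsTree
  r1 : V
  r2 : V
  r1_mem : r1 ∈ tree.verts
  r2_mem : r2 ∈ tree.verts

/-- A triply rooted tree with vertex set all of `V`. -/
@[ext]
structure TriplyRootedTree (V : Type*) where
  graph : SimpleGraph V
  isTree : graph.IsTree
  r1 : V
  r2 : V
  r3 : V

/-- The vertex set of a possibly empty doubly rooted tree; `none` is the empty one. -/
def vertexSet {V : Type*} : Option (DoublyRootedTree V) → Set V
  | none => ∅
  | some E => E.tree.verts

/-- `(X, Y, Z)` is a composition of the whole of `V`. The sets may be empty. -/
def IsComposition {V : Type*} (X Y Z : Set V) : Prop :=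
  Disjoint X Y ∧ Disjoint X Z ∧ Disjoint Y Z ∧ X ∪ Y ∪ Z = Set.univ

/-- Triples `(D, D', D'')` of doubly rooted trees whose vertex sets form a composition of `V`;
`D` is nonempty, while `D'` and `D''` may be empty. -/
@[ext]
structure TreeTriple (V : Type*) where
  D : DoublyRootedTree V
  D' : Option (DoublyRootedTree V)
  D'' : Option (DoublyRootedTree V)
  comp : IsComposition D.tree.verts (vertexSet D') (vertexSet D'')

/-- `Q_n`, with `[n]` modelled by `Fin n`. -/
abbrev Q (n : ℕ) := TreeTriple (Fin n)

/-- `T_n`, with `[n]` modelled by `Fin n`. -/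
abbrev T (n : ℕ) := TriplyRootedTree (Fin n)

section Merging

variable {V : Type*}

/-- The edges contributed by a possibly empty tree `E` hung below the vertex `v`: those of `E`
and the edge from `v` to the first root of `E`. -/
def hang (v : V) : Option (DoublyRootedTree V) → SimpleGraph V
  | none => ⊥
  | some E => E.tree.spanningCoe ⊔ SimpleGraph.edge v E.r1

/-- The second root of `E`, or `v` if `E` is empty. -/
def endRoot (v : V) : Option (DoublyRootedTree V) → V
  | none => v
  | some E => E.r2

/-- `t` is the result of merging the triple `q`. -/
def IsMerge (q : TreeTriple V) (t : TriplyRootedTree V) : Prop :=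
  t.graph = q.D.tree.spanningCoe ⊔ hang q.D.r2 q.D' ⊔ hang q.D.r2 q.D'' ∧
  t.r1 = q.D.r1 ∧ t.r2 = endRoot q.D.r2 q.D' ∧ t.r3 = endRoot q.D.r2 q.D''

end Merging

section Splitting

variable {V : Type*}

/-- In the tree `G` rooted at `r`, the vertex `i` lies on the path from `r` to `j`. -/
def IsAncestor (G : SimpleGraph V) (r i j : V) : Prop :=
  ∃ p : G.Walk r j, p.IsPath ∧ i ∈ p.support

/-- In the tree `G` rooted at `r`, the vertex `j` is a child of `i`. -/
def IsChild (G : SimpleGraph V) (r j i : V) : Prop :=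
  IsAncestor G r i j ∧ G.Adj i j

/-- In the tree `G` rooted at `r`, the vertex `w` is a common ancestor of `a` and `b` of largest
depth (the depth of a vertex of a tree is its distance from the root). -/
def IsLCA (G : SimpleGraph V) (r a b w : V) : Prop :=
  IsAncestor G r w a ∧ IsAncestor G r w b ∧
  ∀ u, IsAncestor G r u a → IsAncestor G r u b → G.dist r u ≤ G.dist r w

/-- The tree of `t` without the edges from `w` to those children of `w` of which the second or the
third root is a descendant. -/
def cutGraph (t : TriplyRootedTree V) (w : V) : SimpleGraph V :=
  t.graph.deleteEdges {e | ∃ x, IsChild t.graph t.r1 x w ∧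
    (IsAncestor t.graph t.r1 x t.r2 ∨ IsAncestor t.graph t.r1 x t.r3) ∧ e = s(w, x)}

/-- The underlying tree of `E` is the connected component of `H` that contains the first root
of `E`. -/
def IsComponentOf (H : SimpleGraph V) (E : DoublyRootedTree V) : Prop :=
  E.tree.verts = {v | H.Reachable E.r1 v} ∧
  ∀ u v, E.tree.Adj u v ↔ u ∈ E.tree.verts ∧ v ∈ E.tree.verts ∧ H.Adj u v

/-- The part `E` cut off below `w` on the way to the root `s`: empty if `w = s`; otherwise
it is the component of the cut graph whose first root is the child of `w` that is an ancestor
of `s`, and its second root is `s`. -/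
def IsBranch (t : TriplyRootedTree V) (w s : V) (E : Option (DoublyRootedTree V)) : Prop :=
  (w = s ∧ E = none) ∨
  (w ≠ s ∧ ∃ F, E = some F ∧ IsChild t.graph t.r1 F.r1 w ∧ IsAncestor t.graph t.r1 F.r1 s ∧
    F.r2 = s ∧ IsComponentOf (cutGraph t w) F)

/-- `q` is the result of splitting `t` at the vertex `w`. -/
def IsSplit (t : TriplyRootedTree V) (w : V) (q : TreeTriple V) : Prop :=
  q.D.r1 = t.r1 ∧ q.D.r2 = w ∧ IsComponentOf (cutGraph t w) q.D ∧
  IsBranch t w t.r2 q.D' ∧ IsBranch t w t.r3 q.D''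

end Splitting

/-- The double sum over `1 ≤ j ≤ n` and `0 ≤ k ≤ n - j`; the subtractions never truncate, and
`0 ^ 0 = 1`. -/
def tripleSum (n : ℕ) : ℕ :=
  ∑ j ∈ Finset.Icc 1 n, ∑ k ∈ Finset.range (n - j + 1),
    n.choose j * (n - j).choose k * j ^ j * k ^ k * (n - j - k) ^ (n - j - k)

noncomputable def xi (n : ℕ) : ℝ :=
  ∑ k ∈ Finset.range (n + 1),
    (n.choose k : ℝ) * ((k : ℝ) / n) ^ k * (1 - (k : ℝ) / n) ^ (n - k)

noncomputable def xi₂ (n : ℕ) : ℝ :=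
  ∑ j ∈ Finset.range (n + 1), ∑ k ∈ Finset.range (n - j + 1),
    (n.choose j : ℝ) * ((n - j).choose k : ℝ) * ((j : ℝ) / n) ^ j * ((k : ℝ) / n) ^ k *
      (1 - (j : ℝ) / n - (k : ℝ) / n) ^ (n - j - k)

end TriplyRooted

/-! In a merged tree the path from the first root to the second runs inside D to r₂(D) and then
inside D'; the path to the third root runs through D'' in the same way. As D' and D'' are disjoint,
r₂(D) is the deepest common ancestor of the two ends, and the edges cut there are exactly those that
merging has added. So splitting recovers the triple, and merging is injective
(`TreeTriple.isLCA_merge`, `TreeTriple.cutGraph_merge`, `merge_injective`). Conversely, cut any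
triply rooted tree below the least common ancestor w. The pieces are disjoint, the two branches
because a child of w shared by them would be a deeper common ancestor, and they exhaust the tree;
merging them restores it (`exists_isSplit`, `IsSplit.merge_eq`).

Both cardinalities rest on Cayley's formula: there are k ^ k doubly rooted trees on k ≥ 1 points, so
choosing the vertex sets gives the double sum, and three roots on n ^ (n - 2) trees give n ^ (n +
1). Cayley's formula comes from a recursion for the number of forests with a prescribed root set R:
turning a non-root u into a root and remembering its former parent relates the forests for R to
those for R ∪ {u} (`card_forestMaps_step`). Lacasse's identity is the equality of the two counts
divided by n ^ n. -/

namespace TriplyRooted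

open Relation

/-! ### Rooted forests as parent maps, counted by root set -/

section ForestMaps

variable {V : Type*}

/-- The vertex `b` is an iterated image of `a` under `f`. -/
abbrev Orb (f : V → V) : V → V → Prop := ReflTransGen (fun a b => f a = b)

theorem Orb.eq_of_fixed {f : V → V} {r x : V} (hr : f r = r) (h : Orb f r x) : x = r := by
  induction h with
  | refl => rfl
  | tail _ h2 ih => rw [← h2, ih, hr]

/-- A vertex on a cycle can be reached again from every point of its orbit, but from a fixed point
only that point itself is reached. -/
theorem Orb.eq_of_cycle {f : V → V} {u r : V} (hu : Orb f (f u) u) (h : Orb f u r)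
    (hr : f r = r) : u = r := by
  have key : Orb f r u := by
    clear hr
    induction h with
    | refl => exact .refl
    | @tail b c _ h2 ih =>
      rcases ih.cases_head with rfl | ⟨d, hd, hd'⟩
      · rwa [← h2]
      · rwa [← h2, hd]
  exact Orb.eq_of_fixed hr key

theorem Orb.unique_fixed {f : V → V} {v a b : V} (ha : Orb f v a) (hb : Orb f v b)
    (hfa : f a = a) (hfb : f b = b) : a = b := by
  rcases ReflTransGen.total_of_right_unique (fun _ _ _ h h' => h.symm.trans h') ha hb with h | h
  · exact (Orb.eq_of_fixed hfa h).symm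
  · exact Orb.eq_of_fixed hfb h

/-- The map `f` is the parent map of a forest with root set `R`: it fixes the roots, and
every vertex has a root among its iterated images. -/
def IsForestMap (R : Finset V) (f : V → V) : Prop :=
  (∀ r ∈ R, f r = r) ∧ ∀ v, ∃ r ∈ R, Orb f v r

theorem Orb.conj {f : V → V} (σ : Equiv.Perm V) {a b : V} (h : Orb f a b) :
    Orb (σ ∘ f ∘ σ.symm) (σ a) (σ b) :=
  h.lift σ (fun a b hab => by simp [Function.onFun, hab])

theorem IsForestMap.conj {R : Finset V} {f : V → V} (hf : IsForestMap R f) (σ : Equiv.Perm V)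
    (hσ : ∀ r, σ r ∈ R ↔ r ∈ R) : IsForestMap R (σ ∘ f ∘ σ.symm) := by
  refine ⟨fun r hr => ?_, fun v => ?_⟩
  · have : σ.symm r ∈ R := by rw [← hσ]; simpa
    simp [hf.1 _ this]
  · obtain ⟨r, hr, h⟩ := hf.2 (σ.symm v)
    exact ⟨σ r, (hσ r).2 hr, by simpa using h.conj σ⟩

variable [DecidableEq V]

/-- The orbit of v under the changed map agrees with the old one until it meets u. -/
theorem Orb.of_update {f : V → V} {u p v x : V} (h : Orb f v x) :
    Orb (Function.update f u p) v x ∨ Orb (Function.update f u p) v u := by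
  induction h using ReflTransGen.head_induction_on with
  | refl => exact .inl .refl
  | @head a c h1 _ ih =>
    by_cases hau : a = u
    · subst hau; exact .inr .refl
    · have : Function.update f u p a = c := by rw [Function.update_of_ne hau, h1]
      exact ih.imp (.head this) (.head this)

theorem Orb.update_of_hit {f : V → V} {u p v : V} (h : Orb f v u) :
    Orb (Function.update f u p) v u := by
  rcases h.of_update (u := u) (p := p) with h | h <;> exact h

theorem IsForestMap.insert {R : Finset V} {f : V → V} (hf : IsForestMap R f) (u : V) :
    IsForestMap (insert u R) (Function.update f u u) := by
  refine ⟨fun r hr => ?_, fun v => ?_⟩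
  · by_cases h : r = u
    · subst h; simp
    · rw [Function.update_of_ne h]
      exact hf.1 r (by simpa [h] using hr)
  · obtain ⟨r, hr, h⟩ := hf.2 v
    rcases h.of_update (u := u) (p := u) with h | h
    · exact ⟨r, by simp [hr], h⟩
    · exact ⟨u, by simp, h⟩

/-- If the former parent of u still led to u, then u would lie on a cycle of f and so be a root. -/
theorem IsForestMap.not_orb {R : Finset V} {f : V → V} (hf : IsForestMap R f) {u : V}
    (hu : u ∉ R) : ¬ Orb (Function.update f u u) (f u) u := by
  intro h
  have h' : Orb f (f u) u := by
    have := h.update_of_hit (p := f u)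
    simpa using this
  obtain ⟨r, hr, h2⟩ := hf.2 u
  exact hu (Orb.eq_of_cycle h' h2 (hf.1 r hr) ▸ hr)

/-- A vertex p outside the tree of u reaches some other root without meeting u; orbits that meet u
can continue along that of p. -/
theorem IsForestMap.update {R : Finset V} {f : V → V} {u p : V} (hu : u ∉ R)
    (hf : IsForestMap (Insert.insert u R) f) (hp : ¬ Orb f p u) :
    IsForestMap R (Function.update f u p) := by
  have hpR : ∃ r ∈ R, Orb (Function.update f u p) p r := by
    obtain ⟨r, hr, h⟩ := hf.2 p
    have hru : r ≠ u := by rintro rfl; exact hp h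
    refine ⟨r, by simpa [hru] using hr, ?_⟩
    rcases h.of_update (u := u) (p := p) with h' | h'
    · exact h'
    -- Resetting the value at u to `f u` gives back f, and an orbit that hits u does so whatever the
    -- value at u is.
    · refine absurd ?_ hp
      have := h'.update_of_hit (p := f u)
      simpa using this
  refine ⟨fun r hr => ?_, fun v => ?_⟩
  · rw [Function.update_of_ne (by rintro rfl; exact hu hr)]
    exact hf.1 r (by simp [hr])
  · obtain ⟨r, hr, h⟩ := hf.2 v
    have hit : Orb (Function.update f u p) v u → ∃ r ∈ R, Orb (Function.update f u p) v r := by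
      intro h'
      obtain ⟨s, hs, h2⟩ := hpR
      exact ⟨s, hs, h'.trans (.head (by simp) h2)⟩
    rcases h.of_update (u := u) (p := p) with h' | h'
    · by_cases hru : r = u
      · subst hru; exact hit h'
      · exact ⟨r, by simpa [hru] using hr, h'⟩
    · exact hit h'

variable [Fintype V]

open Classical in
/-- The parent maps of the forests with root set `R`. -/
noncomputable def forestMaps (R : Finset V) : Finset (V → V) :=
  Finset.univ.filter (IsForestMap R)

open Classical in
/-- Pairs of a forest with root set `R` and a vertex in the tree of the root `ρ`. -/
noncomputable def pointedForests (R : Finset V) (ρ : V) : Finset ((V → V) × V) :=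
  (forestMaps R ×ˢ Finset.univ).filter fun x => Orb x.1 x.2 ρ

theorem mem_forestMaps {R : Finset V} {f : V → V} : f ∈ forestMaps R ↔ IsForestMap R f := by
  simp [forestMaps]

theorem mem_pointedForests {R : Finset V} {ρ : V} {x : (V → V) × V} :
    x ∈ pointedForests R ρ ↔ IsForestMap R x.1 ∧ Orb x.1 x.2 ρ := by
  simp [pointedForests, mem_forestMaps]

/-- Every vertex lies in the tree of exactly one root. -/
theorem sum_card_pointedForests (R : Finset V) :
    ∑ ρ ∈ R, (pointedForests R ρ).card = (forestMaps R).card * Fintype.card V := by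
  classical
  rw [← Finset.card_biUnion, ← Finset.card_univ, ← Finset.card_product]
  · congr 1
    ext x
    simp only [Finset.mem_biUnion, mem_pointedForests, Finset.mem_product, mem_forestMaps,
      Finset.mem_univ, and_true]
    constructor
    · rintro ⟨_, _, h, _⟩; exact h
    · intro h
      obtain ⟨r, hr, h2⟩ := h.2 x.2
      exact ⟨r, hr, h, h2⟩
  · intro a ha b hb hab
    rw [Function.onFun, Finset.disjoint_left]
    intro x hx hx'
    rw [mem_pointedForests] at hx hx'
    exact hab (Orb.unique_fixed hx.2 hx'.2 (hx.1.1 a ha) (hx.1.1 b hb))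

/-- Conjugation by the transposition of a and b preserves the root set and carries the tree of a to
that of b. Used in both directions, this gives equality. -/
theorem card_pointedForests_le (R : Finset V) {a b : V} (ha : a ∈ R) (hb : b ∈ R) :
    (pointedForests R a).card ≤ (pointedForests R b).card := by
  have hσ : ∀ r, Equiv.swap a b r ∈ R ↔ r ∈ R := by
    intro r
    by_cases h1 : r = a
    · subst h1; simp [ha, hb]
    by_cases h2 : r = b
    · subst h2; simp [ha, hb]
    rw [Equiv.swap_apply_of_ne_of_ne h1 h2]
  refine Finset.card_le_card_of_injOn
    (fun x => (Equiv.swap a b ∘ x.1 ∘ (Equiv.swap a b).symm, Equiv.swap a b x.2)) ?_ ?_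
  · intro x hx
    simp only [Finset.mem_coe, mem_pointedForests] at hx ⊢
    exact ⟨hx.1.conj _ hσ, by simpa using hx.2.conj (Equiv.swap a b)⟩
  · rintro ⟨f, v⟩ _ ⟨g, w⟩ _ h
    simp only [Prod.mk.injEq, EmbeddingLike.apply_eq_iff_eq] at h
    refine Prod.ext ?_ h.2
    funext x
    have := congrFun h.1 (Equiv.swap a b x)
    simpa using this

/-- A forest with root set R amounts to one with root set R ∪ {u} and a parent for u outside the
tree of u; the pointed forests account for the vertices inside that tree. -/
theorem card_forestMaps_insert (R : Finset V) {u : V} (hu : u ∉ R) :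
    (forestMaps R).card + (pointedForests (insert u R) u).card =
      (forestMaps (insert u R)).card * Fintype.card V := by
  classical
  rw [← Finset.card_univ (α := V), ← Finset.card_product,
    ← Finset.card_filter_add_card_filter_not (s := forestMaps (insert u R) ×ˢ Finset.univ)
      (fun x => Orb x.1 x.2 u), add_comm]
  congr 1
  refine Finset.card_bij' (fun f _ => (Function.update f u u, f u))
    (fun x _ => Function.update x.1 u x.2) ?_ ?_ ?_ ?_
  · intro f hf
    rw [mem_forestMaps] at hf
    simp only [Finset.mem_filter, Finset.mem_product, mem_forestMaps, Finset.mem_univ, and_true]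
    exact ⟨hf.insert u, hf.not_orb hu⟩
  · intro x hx
    simp only [Finset.mem_filter, Finset.mem_product, mem_forestMaps, Finset.mem_univ,
      and_true] at hx ⊢
    exact hx.1.update hu hx.2
  · intro f _; simp
  · intro x hx
    simp only [Finset.mem_filter, Finset.mem_product, mem_forestMaps, Finset.mem_univ,
      and_true] at hx
    have : x.1 u = u := hx.1.1 u (by simp)
    ext1
    · funext v
      by_cases h : v = u
      · subst h; simp [this]
      · simp [h]
    · simp

/-- By symmetry the |R| + 1 roots share the pairs of a forest and a vertex equally, which eliminates
the pointed forests. -/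
theorem card_forestMaps_step (R : Finset V) {u : V} (hu : u ∉ R) :
    (R.card + 1) * (forestMaps R).card =
      Fintype.card V * R.card * (forestMaps (insert u R)).card := by
  have h1 := card_forestMaps_insert R hu
  have h2 := sum_card_pointedForests (insert u R)
  rw [Finset.sum_const_nat (m := (pointedForests (insert u R) u).card) (fun x hx =>
    le_antisymm (card_pointedForests_le _ hx (by simp)) (card_pointedForests_le _ (by simp) hx)),
    Finset.card_insert_of_notMem hu] at h2
  zify at h1 h2 ⊢
  linear_combination (R.card + 1 : ℤ) * h1 - h2

/-- Induction on the number of non-roots. The factor |V| on the left avoids the exponent |V| - |R| -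
1, which would truncate when every vertex is a root. -/
theorem card_forestMaps (R : Finset V) :
    Fintype.card V * (forestMaps R).card =
      R.card * Fintype.card V ^ (Fintype.card V - R.card) := by
  classical
  induction h : Fintype.card V - R.card generalizing R with
  | zero =>
    have hR : R = Finset.univ := by
      rw [← Finset.card_eq_iff_eq_univ]
      have := Finset.card_le_univ R
      omega
    subst hR
    have : forestMaps (Finset.univ : Finset V) = {id} := by
      ext f
      rw [mem_forestMaps, Finset.mem_singleton]
      constructor
      · intro h; funext v; exact h.1 v (by simp)
      · rintro rfl; exact ⟨fun _ _ => rfl, fun v => ⟨v, by simp, .refl⟩⟩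
    simp [this]
  | succ k ih =>
    obtain ⟨u, hu⟩ : ∃ u, u ∉ R := by
      by_contra! hc
      rw [Finset.eq_univ_iff_forall.2 hc] at h
      simp at h
    have h1 := ih (insert u R) (by rw [Finset.card_insert_of_notMem hu]; omega)
    have h2 := card_forestMaps_step R hu
    rw [Finset.card_insert_of_notMem hu] at h1
    apply Nat.eq_of_mul_eq_mul_left (Nat.succ_pos R.card)
    rw [Nat.succ_eq_add_one]
    zify at h1 h2 ⊢
    linear_combination (Fintype.card V : ℤ) * h2 + (Fintype.card V * R.card : ℤ) * h1

end ForestMaps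

/-! ### Cayley's formula -/

section Cayley

variable {V : Type*}

/-- The graph in which every vertex is joined to its image under `f`. -/
def mapGraph (f : V → V) : SimpleGraph V := SimpleGraph.fromRel fun a b => f a = b

theorem mapGraph_adj {f : V → V} {a b : V} :
    (mapGraph f).Adj a b ↔ a ≠ b ∧ (f a = b ∨ f b = a) := by
  simp [mapGraph]

theorem Orb.reachable {f : V → V} {a b : V} (h : Orb f a b) : (mapGraph f).Reachable a b := by
  induction h with
  | refl => exact .rfl
  | @tail b c _ h ih =>
    by_cases hbc : b = c
    · exact hbc ▸ ih
    · exact ih.trans (mapGraph_adj.2 ⟨hbc, .inl h⟩).reachable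

theorem IsForestMap.connected_mapGraph {r : V} {f : V → V} (hf : IsForestMap {r} f) :
    (mapGraph f).Connected := by
  have h : ∀ v, (mapGraph f).Reachable v r := fun v => by
    obtain ⟨s, hs, h⟩ := hf.2 v
    rw [Finset.mem_singleton] at hs
    exact hs ▸ h.reachable
  exact { preconnected := fun a b => (h a).trans (h b).symm, nonempty := ⟨r⟩ }

/-- The graph is connected, and since each edge joins some v ≠ r to its parent, there are at most
|V| - 1 edges. -/
theorem IsForestMap.isTree_mapGraph [Finite V] {r : V} {f : V → V} (hf : IsForestMap {r} f) :
    (mapGraph f).IsTree := by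
  classical
  have := Fintype.ofFinite V
  rw [SimpleGraph.isTree_iff_connected_and_card]
  refine ⟨hf.connected_mapGraph, le_antisymm ?_
    hf.connected_mapGraph.card_vert_le_card_edgeSet_add_one⟩
  have hsub : (mapGraph f).edgeSet ⊆ ((Finset.univ.erase r).image fun v => s(v, f v) :
      Finset (Sym2 V)) := by
    intro e
    induction e with | _ a b
    rw [SimpleGraph.mem_edgeSet, mapGraph_adj]
    have hfr : f r = r := hf.1 r (by simp)
    rintro ⟨hab, h | h⟩
    · simp only [Finset.coe_image, Set.mem_image, Finset.mem_coe]
      exact ⟨a, by simp; rintro rfl; exact hab (hfr.symm.trans h), by rw [h]⟩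
    · simp only [Finset.coe_image, Set.mem_image, Finset.mem_coe]
      exact ⟨b, by simp; rintro rfl; exact hab (h.symm.trans hfr), by rw [h, Sym2.eq_swap]⟩
  have h1 : Nat.card (mapGraph f).edgeSet ≤ Fintype.card V - 1 := by
    rw [Nat.card_coe_set_eq]
    refine (Set.ncard_le_ncard hsub).trans ?_
    rw [Set.ncard_coe_finset]
    refine Finset.card_image_le.trans ?_
    rw [Finset.card_erase_of_mem (Finset.mem_univ r), Finset.card_univ]
  have : 0 < Fintype.card V := Fintype.card_pos_iff.2 ⟨r⟩
  rw [Nat.card_eq_fintype_card (α := V)]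
  omega

theorem IsForestMap.mapGraph_injective {r : V} {f g : V → V} (hf : IsForestMap {r} f)
    (hg : IsForestMap {r} g) (h : mapGraph f = mapGraph g) : f = g := by
  have hfr : f r = r := hf.1 r (by simp)
  have hgr : g r = r := hg.1 r (by simp)
  funext v
  obtain ⟨s, hs, hv⟩ := hf.2 v
  rw [Finset.mem_singleton] at hs
  subst hs
  induction hv using ReflTransGen.head_induction_on with
  | refl => rw [hfr, hgr]
  | @head a c hac hcs ih =>
    by_cases hne : a = c
    · subst hne; exact ih
    have : (mapGraph g).Adj a c := h ▸ mapGraph_adj.2 ⟨hne, .inl hac⟩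
    rcases (mapGraph_adj.1 this).2 with h' | h'
    -- In the other case c, on which f and g agree by induction, has parent a; then a and c form a
    -- cycle of f, which forces a to be the root.
    · rw [hac, h']
    · have hca : f c = a := ih.trans h'
      have : a = s := Orb.eq_of_cycle (f := f) (by rw [hac]; exact .single hca)
        (.head hac hcs) hfr
      rw [this, hfr, hgr]

/-- Take as parent a neighbour closer to r. The resulting graph is a connected subgraph of G, hence
all of G, because a tree is minimally connected. -/
theorem exists_mapGraph_eq {G : SimpleGraph V} (hG : G.IsTree) (r : V) :
    ∃ f, IsForestMap {r} f ∧ mapGraph f = G := by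
  classical
  have key : ∀ v, v ≠ r → ∃ u, G.Adj v u ∧ G.dist u r < G.dist v r := by
    intro v hv
    obtain ⟨p, hp⟩ := hG.connected.exists_walk_length_eq_dist v r
    cases p with
    | nil => exact absurd rfl hv
    | @cons _ u _ h p =>
      refine ⟨u, h, ?_⟩
      have := SimpleGraph.dist_le p
      simp at hp
      omega
  choose! f hadj hdist using key
  let g := Function.update f r r
  have hgr : g r = r := by simp [g]
  have hg : ∀ v, v ≠ r → g v = f v := fun v hv => by simp [g, hv]
  have hforest : IsForestMap {r} g := by
    refine ⟨by simp [hgr], fun v => ⟨r, by simp, ?_⟩⟩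
    induction hn : G.dist v r using Nat.strong_induction_on generalizing v with
    | _ n ih =>
      by_cases hv : v = r
      · subst hv; exact .refl
      · exact .head (hg v hv) (ih _ (hn ▸ hdist v hv) (f v) rfl)
  refine ⟨g, hforest, ?_⟩
  have hle : mapGraph g ≤ G := by
    intro a b hab
    rw [mapGraph_adj] at hab
    obtain ⟨hne, h | h⟩ := hab
    · have : a ≠ r := by rintro rfl; exact hne (hgr.symm.trans h)
      rw [← h, hg a this]; exact hadj a this
    · have : b ≠ r := by rintro rfl; exact hne (h.symm.trans hgr)
      rw [← h, hg b this]; exact (hadj b this).symm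
  exact le_antisymm hle
    ((SimpleGraph.isTree_iff_minimal_connected.1 hG).le_of_le hforest.connected_mapGraph hle)

/-- **Cayley's formula**, with the quotient cleared. -/
theorem card_isTree_mul_sq (V : Type*) [Finite V] [Nonempty V] :
    Nat.card {G : SimpleGraph V // G.IsTree} * Nat.card V ^ 2 = Nat.card V ^ Nat.card V := by
  classical
  have := Fintype.ofFinite V
  obtain ⟨r⟩ := ‹Nonempty V›
  have e : Nat.card (forestMaps ({r} : Finset V)) =
      Nat.card {G : SimpleGraph V // G.IsTree} := by
    refine Nat.card_congr (Equiv.ofBijective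
      (fun f => ⟨mapGraph f.1, (mem_forestMaps.1 f.2).isTree_mapGraph⟩) ⟨?_, ?_⟩)
    · intro f g h
      exact Subtype.ext ((mem_forestMaps.1 f.2).mapGraph_injective (mem_forestMaps.1 g.2)
        (congrArg Subtype.val h))
    · rintro ⟨G, hG⟩
      obtain ⟨f, hf, h⟩ := exists_mapGraph_eq hG r
      exact ⟨⟨f, mem_forestMaps.2 hf⟩, Subtype.ext h⟩
  have h := card_forestMaps ({r} : Finset V)
  rw [Finset.card_singleton, one_mul] at h
  rw [← e, Nat.card_eq_fintype_card, Nat.card_eq_fintype_card, Fintype.card_coe, sq,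
    ← mul_assoc, mul_comm (Finset.card _), h, ← pow_succ]
  have : 0 < Fintype.card V := Fintype.card_pos_iff.2 ⟨r⟩
  congr 1
  omega

end Cayley

/-! ### Cardinalities of the two sides -/

section Counting

variable {V : Type*}

/-- A tree on the vertex set `A` with two roots as a doubly rooted tree. -/
def DoublyRootedTree.ofGraph {A : Set V} (G : SimpleGraph A) (hG : G.IsTree) (a b : A) :
    DoublyRootedTree V where
  tree :=
    { verts := A
      Adj := fun u v => ∃ (hu : u ∈ A) (hv : v ∈ A), G.Adj ⟨u, hu⟩ ⟨v, hv⟩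
      adj_sub := by
        rintro u v ⟨hu, hv, h⟩
        simpa using h.ne
      edge_vert := fun ⟨hu, _, _⟩ => hu
      symm := ⟨fun u v ⟨hu, hv, h⟩ => ⟨hv, hu, h.symm⟩⟩ }
  isTree := by
    convert hG
    ext u v
    simp
  r1 := a
  r2 := b
  r1_mem := a.2
  r2_mem := b.2

instance [Finite V] : Finite (DoublyRootedTree V) := by
  refine Finite.of_injective
    (fun E : DoublyRootedTree V => (E.tree.verts, E.tree.Adj, E.r1, E.r2)) ?_
  intro E F h
  simp only [Prod.mk.injEq] at h
  exact DoublyRootedTree.ext (SimpleGraph.Subgraph.ext h.1 h.2.1) h.2.2.1 h.2.2.2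

instance [Finite V] : Finite (TreeTriple V) :=
  Finite.of_injective (fun q : TreeTriple V => (q.D, q.D', q.D'')) (by
    intro p q h
    simp only [Prod.mk.injEq] at h
    exact TreeTriple.ext h.1 h.2.1 h.2.2)

theorem card_doublyRootedTree [Finite V] (A : Set V) (hA : A.Nonempty) :
    Nat.card {E : DoublyRootedTree V // E.tree.verts = A} = A.ncard ^ A.ncard := by
  have := hA.to_subtype
  rw [← Nat.card_coe_set_eq, ← card_isTree_mul_sq A, sq, ← Nat.card_prod, ← Nat.card_prod]
  refine (Nat.card_congr (Equiv.ofBijective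
    (fun x : {G : SimpleGraph A // G.IsTree} × A × A =>
      ⟨DoublyRootedTree.ofGraph x.1.1 x.1.2 x.2.1 x.2.2, rfl⟩) ⟨?_, ?_⟩)).symm
  · rintro ⟨⟨G, hG⟩, a, b⟩ ⟨⟨G', hG'⟩, a', b'⟩ h
    have h' := congrArg Subtype.val h
    have h1 : a.1 = a'.1 := congrArg DoublyRootedTree.r1 h'
    have h2 : b.1 = b'.1 := congrArg DoublyRootedTree.r2 h'
    have h3 := congrArg (fun E => E.tree.Adj) h'
    have h4 : G = G' := by
      ext u v
      have := congrFun (congrFun h3 u) v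
      simpa [DoublyRootedTree.ofGraph] using this
    rw [Subtype.ext h1, Subtype.ext h2]
    subst h4
    rfl
  · rintro ⟨E, rfl⟩
    refine ⟨⟨⟨E.tree.coe, E.isTree⟩, ⟨E.r1, E.r1_mem⟩, ⟨E.r2, E.r2_mem⟩⟩, ?_⟩
    refine Subtype.ext (DoublyRootedTree.ext (SimpleGraph.Subgraph.ext rfl ?_) rfl rfl)
    ext u v
    simp only [DoublyRootedTree.ofGraph, SimpleGraph.Subgraph.coe_adj, exists_prop]
    exact ⟨fun h => h.2.2, fun h => ⟨h.fst_mem, h.snd_mem, h⟩⟩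

theorem card_doublyRootedTree_empty :
    Nat.card {E : DoublyRootedTree V // E.tree.verts = ∅} = 0 := by
  have : IsEmpty {E : DoublyRootedTree V // E.tree.verts = ∅} :=
    ⟨fun E => by simpa [E.2] using E.1.r1_mem⟩
  exact Nat.card_of_isEmpty

/-- Allowing the empty tree makes the formula hold for A = ∅ as well, where 0 ^ 0 = 1 counts it. -/
theorem card_option_doublyRootedTree [Finite V] (A : Set V) :
    Nat.card {E : Option (DoublyRootedTree V) // vertexSet E = A} = A.ncard ^ A.ncard := by
  rcases A.eq_empty_or_nonempty with rfl | hA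
  · rw [Set.ncard_empty, pow_zero, Nat.card_eq_one_iff_unique]
    refine ⟨⟨?_⟩, ⟨⟨none, rfl⟩⟩⟩
    have key : ∀ E : {E : Option (DoublyRootedTree V) // vertexSet E = ∅}, E.1 = none := by
      rintro ⟨_ | E, hE⟩
      · rfl
      · have hE' : E.tree.verts = ∅ := hE
        simpa [hE'] using E.r1_mem
    exact fun E F => Subtype.ext ((key E).trans (key F).symm)
  · rw [← card_doublyRootedTree A hA]
    refine (Nat.card_congr (Equiv.ofBijective (fun E => ⟨some E.1, E.2⟩) ⟨?_, ?_⟩)).symm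
    · intro E F h
      exact Subtype.ext (Option.some_injective _ (congrArg Subtype.val h))
    · rintro ⟨_ | E, rfl⟩
      · exact absurd hA (by simp [vertexSet])
      · exact ⟨⟨E, rfl⟩, rfl⟩

theorem IsComposition.compl_eq {X Y Z : Set V} (h : IsComposition X Y Z) : (X ∪ Y)ᶜ = Z := by
  obtain ⟨_, h2, h3, h4⟩ := h
  exact IsCompl.compl_eq ⟨Set.disjoint_union_left.2 ⟨h2, h3⟩,
    codisjoint_iff.2 h4⟩

theorem isComposition_compl {X Y : Set V} (h : Disjoint X Y) :
    IsComposition X Y (X ∪ Y)ᶜ :=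
  ⟨h, disjoint_compl_right.mono_left Set.subset_union_left,
    disjoint_compl_right.mono_left Set.subset_union_right, Set.union_compl_self _⟩

theorem card_treeTriple_fiber [Finite V] (A B : Set V) (h : Disjoint A B) :
    Nat.card {q : TreeTriple V // (q.D.tree.verts, vertexSet q.D') = (A, B)} =
      Nat.card {E : DoublyRootedTree V // E.tree.verts = A} * (B.ncard ^ B.ncard *
        (A ∪ B)ᶜ.ncard ^ (A ∪ B)ᶜ.ncard) := by
  rw [← card_option_doublyRootedTree B, ← card_option_doublyRootedTree (A ∪ B)ᶜ,
    ← Nat.card_prod, ← Nat.card_prod]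
  refine (Nat.card_congr (Equiv.ofBijective (fun x => ⟨⟨x.1.1, x.2.1.1, x.2.2.1, by
    rw [x.1.2, x.2.1.2, x.2.2.2]; exact isComposition_compl h⟩, by
    simp only [x.1.2, x.2.1.2]⟩) ⟨?_, ?_⟩)).symm
  · rintro ⟨⟨D, _⟩, ⟨D', _⟩, D'', _⟩ ⟨⟨E, _⟩, ⟨E', _⟩, E'', _⟩ h
    simpa using h
  · rintro ⟨q, hq⟩
    have h1 : q.D.tree.verts = A := congrArg Prod.fst hq
    have h2 : vertexSet q.D' = B := congrArg Prod.snd hq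
    refine ⟨⟨⟨q.D, h1⟩, ⟨q.D', h2⟩, ⟨q.D'', ?_⟩⟩, rfl⟩
    rw [← h1, ← h2, q.comp.compl_eq]

theorem sum_powerset_card (f : ℕ → ℕ) (S : Finset V) :
    ∑ B ∈ S.powerset, f B.card = ∑ k ∈ Finset.range (S.card + 1), S.card.choose k * f k := by
  rw [Finset.sum_powerset_apply_card]; simp

theorem card_treeTriple (V : Type*) [Finite V] :
    Nat.card (TreeTriple V) = tripleSum (Nat.card V) := by
  classical
  have := Fintype.ofFinite V
  rw [Nat.card_eq_fintype_card (α := V)]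
  set n := Fintype.card V with hn
  let F : TreeTriple V → Finset V × Finset V :=
    fun q => (q.D.tree.verts.toFinset, (vertexSet q.D').toFinset)
  have hF : ∀ (A B : Finset V) q, F q = (A, B) ↔
      (q.D.tree.verts, vertexSet q.D') = ((A : Set V), (B : Set V)) := by
    intro A B q
    simp only [F, Prod.mk.injEq, ← Finset.coe_inj, Set.coe_toFinset]
  rw [← Nat.card_congr (Equiv.sigmaFiberEquiv F), Nat.card_sigma, Fintype.sum_prod_type]
  let c : ℕ → ℕ := fun a => ∑ k ∈ Finset.range (n - a + 1),
    (n - a).choose k * (k ^ k * (n - a - k) ^ (n - a - k))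
  -- The value at 0 is set apart because D is nonempty while 0 ^ 0 = 1; this is why the outer sum
  -- starts at j = 1.
  let g : ℕ → ℕ := fun a => if a = 0 then 0 else a ^ a * c a
  have key : ∀ A : Finset V, ∑ B : Finset V, Nat.card {q // F q = (A, B)} = g A.card := by
    intro A
    have h1 : ∀ B : Finset V, Nat.card {q // F q = (A, B)} = if B ∈ Aᶜ.powerset then
        Nat.card {E : DoublyRootedTree V // E.tree.verts = (A : Set V)} * (B.card ^ B.card *
          (n - A.card - B.card) ^ (n - A.card - B.card)) else 0 := by
      intro B
      rw [Nat.card_congr (Equiv.subtypeEquivRight (hF A B))]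
      have hdis : B ∈ Aᶜ.powerset ↔ Disjoint (A : Set V) (B : Set V) := by
        rw [Finset.mem_powerset, Finset.disjoint_coe, ← le_compl_iff_disjoint_left]
      by_cases h : Disjoint (A : Set V) (B : Set V)
      · rw [if_pos (hdis.2 h), card_treeTriple_fiber _ _ h, ← Finset.coe_union,
          ← Finset.coe_compl, Set.ncard_coe_finset, Set.ncard_coe_finset, Finset.card_compl,
          Finset.card_union_of_disjoint (Finset.disjoint_coe.1 h), ← hn, Nat.sub_sub]
      · rw [if_neg (hdis.not.2 h)]
        have : IsEmpty {q : TreeTriple V //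
            (q.D.tree.verts, vertexSet q.D') = ((A : Set V), (B : Set V))} := by
          refine ⟨fun ⟨q, hq⟩ => h ?_⟩
          rw [Prod.mk.injEq] at hq
          exact hq.1 ▸ hq.2 ▸ q.comp.1
        exact Nat.card_of_isEmpty
    simp_rw [h1]
    rw [← Finset.sum_filter, Finset.filter_univ_mem, ← Finset.mul_sum,
      sum_powerset_card (fun b => b ^ b * (n - A.card - b) ^ (n - A.card - b)),
      Finset.card_compl, ← hn]
    rcases A.eq_empty_or_nonempty with rfl | hA
    · simp [g, card_doublyRootedTree_empty]
    · rw [card_doublyRootedTree _ (by simpa using hA), Set.ncard_coe_finset]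
      simp [g, c, hA.ne_empty]
  simp_rw [key]
  rw [← Finset.powerset_univ, sum_powerset_card g, Finset.card_univ, ← hn, tripleSum,
    Finset.sum_range_succ']
  rw [show (Finset.Icc 1 n) = Finset.Ico 1 (n + 1) from rfl, Finset.sum_Ico_eq_sum_range]
  simp only [g, c]
  simp only [if_true, mul_zero, add_zero, Nat.add_sub_cancel, Nat.succ_ne_zero, if_false]
  refine Finset.sum_congr rfl fun j _ => ?_
  rw [add_comm 1 j, Finset.mul_sum, Finset.mul_sum]
  refine Finset.sum_congr rfl fun k _ => ?_
  ring

theorem card_triplyRootedTree (V : Type*) [Finite V] [Nonempty V] :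
    Nat.card (TriplyRootedTree V) = Nat.card V ^ (Nat.card V + 1) := by
  rw [pow_succ, ← card_isTree_mul_sq V, sq, ← Nat.card_prod, ← Nat.card_prod, ← Nat.card_prod]
  exact Nat.card_congr
    { toFun := fun t => ((⟨t.graph, t.isTree⟩, t.r1, t.r2), t.r3)
      invFun := fun x => ⟨x.1.1.1, x.1.1.2, x.1.2.1, x.1.2.2, x.2⟩
      left_inv := fun _ => rfl
      right_inv := fun _ => rfl }

end Counting

/-! ### Passage to Lacasse's identity -/

section Lacasse

/-- The terms of ξ₂ with j = 0 add up to ξ, as (0 / n) ^ 0 = 1. -/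
theorem xi₂_sub_xi (n : ℕ) :
    xi₂ n - xi n = ∑ j ∈ Finset.Icc 1 n, ∑ k ∈ Finset.range (n - j + 1),
      (n.choose j : ℝ) * ((n - j).choose k : ℝ) * ((j : ℝ) / n) ^ j * ((k : ℝ) / n) ^ k *
        (1 - (j : ℝ) / n - (k : ℝ) / n) ^ (n - j - k) := by
  rw [xi₂, Finset.sum_range_succ', xi, show (Finset.Icc 1 n) = Finset.Ico 1 (n + 1) from rfl,
    Finset.sum_Ico_eq_sum_range]
  simp [add_comm]

theorem pow_mul_xi₂_sub_xi (n : ℕ) (hn : 1 ≤ n) :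
    (n : ℝ) ^ n * (xi₂ n - xi n) = (tripleSum n : ℝ) := by
  have hn0 : (n : ℝ) ≠ 0 := by positivity
  rw [xi₂_sub_xi, tripleSum, Finset.mul_sum]
  push_cast
  refine Finset.sum_congr rfl fun j hj => ?_
  rw [Finset.mul_sum]
  refine Finset.sum_congr rfl fun k hk => ?_
  rw [Finset.mem_Icc] at hj
  rw [Finset.mem_range] at hk
  -- The third base becomes m / n, and n ^ n = n ^ j * n ^ k * n ^ m clears the three denominators.
  obtain ⟨m, rfl⟩ : ∃ m, n = j + k + m := ⟨n - j - k, by omega⟩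
  have h1 : j + k + m - j - k = m := by omega
  have h2 : (1 : ℝ) - (j : ℝ) / (j + k + m : ℕ) - (k : ℝ) / (j + k + m : ℕ) =
      (m : ℝ) / (j + k + m : ℕ) := by
    field_simp
    push_cast
    ring
  rw [h1, h2, div_pow, div_pow, div_pow, pow_add, pow_add]
  field_simp

theorem lacasse_iff (n : ℕ) (hn : 1 ≤ n) :
    tripleSum n = n ^ (n + 1) ↔ xi₂ n = xi n + n := by
  have h := pow_mul_xi₂_sub_xi n hn
  have hn0 : (n : ℝ) ^ n ≠ 0 := by positivity
  rw [← Nat.cast_inj (R := ℝ), ← h, Nat.cast_pow, pow_succ, mul_right_inj' hn0,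
    sub_eq_iff_eq_add']

end Lacasse

/-! ### Ancestors, depth and children in a rooted tree -/

section Ancestors

variable {V : Type*} {G : SimpleGraph V} {r a b i j s w x y : V}

theorem reachable_mem {S : Set V} (hS : ∀ a b, G.Adj a b → a ∈ S → b ∈ S)
    (h : G.Reachable a b) (ha : a ∈ S) : b ∈ S := by
  obtain ⟨p⟩ := h
  induction p with
  | nil => exact ha
  | cons h _ ih => exact ih (hS _ _ h ha)

theorem isAncestor_iff (hG : G.IsAcyclic) {p : G.Walk r j} (hp : p.IsPath) :
    IsAncestor G r i j ↔ i ∈ p.support := by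
  refine ⟨fun ⟨q, hq, hi⟩ => ?_, fun h => ⟨p, hp, h⟩⟩
  have : p = q := congrArg Subtype.val ((hG.subsingleton_path r j).elim ⟨p, hp⟩ ⟨q, hq⟩)
  rwa [this]

theorem length_eq_dist_of_isPath (hG : G.IsTree) {p : G.Walk a b} (hp : p.IsPath) :
    p.length = G.dist a b := by
  obtain ⟨q, hq, h⟩ := hG.connected.exists_path_of_dist a b
  have : p = q := congrArg Subtype.val
    ((hG.isAcyclic.subsingleton_path a b).elim ⟨p, hp⟩ ⟨q, hq⟩)
  rw [this, h]

theorem isAncestor_refl (hG : G.IsTree) (r j : V) : IsAncestor G r j j := by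
  obtain ⟨p, hp, _⟩ := hG.existsUnique_path r j
  exact ⟨p, hp, p.end_mem_support⟩

theorem isAncestor_root (hG : G.IsTree) (r j : V) : IsAncestor G r r j := by
  obtain ⟨p, hp, _⟩ := hG.existsUnique_path r j
  exact ⟨p, hp, p.start_mem_support⟩

theorem IsAncestor.dist_le (hG : G.IsTree) (h : IsAncestor G r i j) :
    G.dist r i ≤ G.dist r j := by
  classical
  obtain ⟨p, hp, hi⟩ := h
  rw [← length_eq_dist_of_isPath hG hp, ← length_eq_dist_of_isPath hG (hp.takeUntil hi)]
  exact p.length_takeUntil_le_length hi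

/-- All ancestors of j lie on one path, where the depth is the position. Uniqueness of least common
ancestors and of the child on the way to s both follow from this. -/
theorem IsAncestor.eq_of_dist_eq (hG : G.IsTree) (ha : IsAncestor G r a j)
    (hb : IsAncestor G r b j) (h : G.dist r a = G.dist r b) : a = b := by
  classical
  obtain ⟨p, hp, ha⟩ := ha
  rw [isAncestor_iff hG.isAcyclic hp] at hb
  rw [← length_eq_dist_of_isPath hG (hp.takeUntil ha),
    ← length_eq_dist_of_isPath hG (hp.takeUntil hb)] at h
  rw [← p.getVert_length_takeUntil ha, ← p.getVert_length_takeUntil hb, h]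

theorem IsAncestor.antisymm (hG : G.IsTree) (hij : IsAncestor G r i j)
    (hji : IsAncestor G r j i) : i = j :=
  hij.eq_of_dist_eq hG (isAncestor_refl hG r j)
    (le_antisymm (hij.dist_le hG) (hji.dist_le hG))

theorem IsLCA.unique (hG : G.IsTree) {w' : V} (h : IsLCA G r a b w) (h' : IsLCA G r a b w') :
    w' = w :=
  h'.1.eq_of_dist_eq hG h.1
    (le_antisymm (h.2.2 _ h'.1 h'.2.1) (h'.2.2 _ h.1 h.2.1))

theorem exists_isLCA [Finite V] (hG : G.IsTree) (r a b : V) : ∃ w, IsLCA G r a b w := by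
  obtain ⟨w, hw, hmax⟩ := Set.exists_max_image {u | IsAncestor G r u a ∧ IsAncestor G r u b}
    (G.dist r) (Set.toFinite _) ⟨r, isAncestor_root hG r a, isAncestor_root hG r b⟩
  exact ⟨w, hw.1, hw.2, fun u h h' => hmax u ⟨h, h'⟩⟩

theorem IsChild.dist_eq (hG : G.IsTree) (h : IsChild G r x w) :
    G.dist r x = G.dist r w + 1 := by
  have := h.1.dist_le hG
  rcases hG.dist_eq_dist_add_one_of_adj r h.2 with h | h <;> omega

theorem IsChild.not_isAncestor (hG : G.IsTree) (h : IsChild G r x w) :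
    ¬ IsAncestor G r x w :=
  fun h' => h.2.ne (h.1.antisymm hG h')

theorem IsChild.unique (hG : G.IsTree) (hx : IsChild G r x w) (hy : IsChild G r y w)
    (hxs : IsAncestor G r x s) (hys : IsAncestor G r y s) : x = y :=
  hxs.eq_of_dist_eq hG hys ((hx.dist_eq hG).trans (hy.dist_eq hG).symm)

/-- Below a proper ancestor `w` of `s` there is a child `x` of `w` from which `s` can be reached
without passing through `w`. -/
theorem IsAncestor.exists_child (h : IsAncestor G r w s) (hne : w ≠ s) :
    ∃ x, IsChild G r x w ∧ IsAncestor G r x s ∧ ∃ p : G.Walk x s, w ∉ p.support := by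
  classical
  obtain ⟨p, hp, hw⟩ := h
  have hdrop := hp.dropUntil hw
  have hspec := p.take_spec hw
  generalize p.dropUntil w hw = d at hdrop hspec
  cases d with
  | nil => exact absurd rfl hne
  | @cons _ x _ hadj d =>
    have hxp : x ∈ p.support := by rw [← hspec]; simp
    rw [SimpleGraph.Walk.cons_isPath_iff] at hdrop
    have hx : x ∉ (p.takeUntil w hw).support := by
      intro hx
      have h2 := hp.support_nodup
      rw [← hspec, SimpleGraph.Walk.support_append, SimpleGraph.Walk.support_cons,
        List.tail_cons, List.nodup_append'] at h2
      exact h2.2.2 hx d.start_mem_support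
    exact ⟨x, ⟨⟨(p.takeUntil w hw).concat hadj, (hp.takeUntil hw).concat hx hadj, by simp⟩,
      hadj⟩, ⟨p, hp, hxp⟩, d, hdrop.2⟩

end Ancestors

/-! ### Doubly rooted trees as components of a graph -/

section Components

variable {V : Type*} {H : SimpleGraph V} {E F : DoublyRootedTree V}

theorem DoublyRootedTree.exists_path (E : DoublyRootedTree V) {u v : V} (hu : u ∈ E.tree.verts)
    (hv : v ∈ E.tree.verts) (h : E.tree.spanningCoe ≤ H) :
    ∃ p : H.Walk u v, p.IsPath ∧ ∀ x ∈ p.support, x ∈ E.tree.verts := by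
  obtain ⟨p, hp, _⟩ := E.isTree.existsUnique_path ⟨u, hu⟩ ⟨v, hv⟩
  let f : E.tree.coe →g H := ⟨Subtype.val, fun hab => h hab⟩
  refine ⟨p.map f, hp.map Subtype.val_injective, ?_⟩
  intro x hx
  rw [SimpleGraph.Walk.support_map, List.mem_map] at hx
  obtain ⟨y, _, rfl⟩ := hx
  exact y.2

theorem isComponentOf_of_closed (hle : E.tree.spanningCoe ≤ H)
    (hcl : ∀ a b, H.Adj a b → a ∈ E.tree.verts → E.tree.Adj a b) : IsComponentOf H E := by
  refine ⟨?_, fun u v => ⟨fun h => ⟨h.fst_mem, h.snd_mem, hle h⟩, fun h => hcl u v h.2.2 h.1⟩⟩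
  ext v
  constructor
  · intro hv
    obtain ⟨p, _⟩ := E.exists_path E.r1_mem hv hle
    exact ⟨p⟩
  · intro hv
    exact reachable_mem (fun a b hab ha => (hcl a b hab ha).snd_mem) hv E.r1_mem

theorem IsComponentOf.le (h : IsComponentOf H E) : E.tree.spanningCoe ≤ H :=
  fun u v huv => ((h.2 u v).1 huv).2.2

theorem IsComponentOf.mem_of_adj (h : IsComponentOf H E) {a b : V} (hab : H.Adj a b)
    (ha : a ∈ E.tree.verts) : b ∈ E.tree.verts := by
  rw [h.1] at ha ⊢
  exact SimpleGraph.Reachable.trans ha hab.reachable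

theorem IsComponentOf.adj (h : IsComponentOf H E) {a b : V} (hab : H.Adj a b)
    (ha : a ∈ E.tree.verts) : E.tree.Adj a b :=
  (h.2 a b).2 ⟨ha, h.mem_of_adj hab ha, hab⟩

theorem IsComponentOf.reachable (h : IsComponentOf H E) {a b : V} (ha : a ∈ E.tree.verts)
    (hb : b ∈ E.tree.verts) : H.Reachable a b := by
  rw [h.1] at ha hb
  exact SimpleGraph.Reachable.trans (SimpleGraph.Reachable.symm ha) hb

theorem IsComponentOf.disjoint (hE : IsComponentOf H E) (hF : IsComponentOf H F) {a b : V}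
    (ha : a ∈ E.tree.verts) (hb : b ∈ F.tree.verts) (h : ¬ H.Reachable a b) :
    Disjoint E.tree.verts F.tree.verts :=
  Set.disjoint_left.2 fun _ hx hx' => h ((hE.reachable ha hx).trans (hF.reachable hx' hb))

theorem IsComponentOf.eq (hE : IsComponentOf H E) (hF : IsComponentOf H F) (h1 : E.r1 = F.r1)
    (h2 : E.r2 = F.r2) : E = F := by
  have hv : E.tree.verts = F.tree.verts := by rw [hE.1, hF.1, h1]
  refine DoublyRootedTree.ext (SimpleGraph.Subgraph.ext hv ?_) h1 h2
  ext u v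
  rw [hE.2, hF.2, hv]

/-- A closed walk cannot leave its component, so a cycle through v would be a cycle of the tree E.
-/
theorem IsComponentOf.not_isCycle (h : IsComponentOf H E) {v : V} (hv : v ∈ E.tree.verts)
    (c : H.Walk v v) : ¬ c.IsCycle := by
  classical
  intro hc
  have hsup : ∀ x ∈ c.support, x ∈ E.tree.verts := fun x hx =>
    reachable_mem (fun a b hab ha => h.mem_of_adj hab ha) ⟨c.takeUntil x hx⟩ hv
  let f : H.induce E.tree.verts →g E.tree.coe := ⟨id, fun {a b} hab => h.adj hab a.2⟩
  have hac : (H.induce E.tree.verts).IsAcyclic :=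
    E.isTree.isAcyclic.comap f Function.injective_id
  refine hac (c.induce _ hsup) ?_
  rw [← SimpleGraph.Walk.isCycle_map_iff_of_injective
    (f := (SimpleGraph.Embedding.induce E.tree.verts).toHom) Subtype.val_injective,
    SimpleGraph.Walk.map_induce]
  exact hc

theorem exists_component (hH : H.IsAcyclic) {a b : V} (h : H.Reachable a b) :
    ∃ E : DoublyRootedTree V, E.r1 = a ∧ E.r2 = b ∧ IsComponentOf H E := by
  have ha : a ∈ (H.connectedComponentMk a).supp := rfl
  have hb : b ∈ (H.connectedComponentMk a).supp :=
    SimpleGraph.ConnectedComponent.eq.2 h.symm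
  refine ⟨DoublyRootedTree.ofGraph _ (hH.isTree_connectedComponent (H.connectedComponentMk a))
    ⟨a, ha⟩ ⟨b, hb⟩, rfl, rfl, ?_, ?_⟩
  · ext v
    exact SimpleGraph.ConnectedComponent.eq.trans SimpleGraph.reachable_comm
  · intro u v
    simp [DoublyRootedTree.ofGraph, SimpleGraph.ConnectedComponent.toSimpleGraph, and_left_comm]

end Components

/-! ### Merging, and splitting a merged tree -/

section Merge

variable {V : Type*}

/-- The edges of a possibly empty tree. -/
def forestPart : Option (DoublyRootedTree V) → SimpleGraph V
  | none => ⊥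
  | some E => E.tree.spanningCoe

/-- The edge by which a possibly empty tree hangs below `w`. -/
def stem (w : V) : Option (DoublyRootedTree V) → SimpleGraph V
  | none => ⊥
  | some E => SimpleGraph.edge w E.r1

theorem hang_eq (w : V) (o : Option (DoublyRootedTree V)) :
    hang w o = forestPart o ⊔ stem w o := by
  cases o <;> simp [hang, forestPart, stem]

theorem forestPart_adj {o : Option (DoublyRootedTree V)} {a b : V} :
    (forestPart o).Adj a b ↔ ∃ E, o = some E ∧ E.tree.Adj a b := by
  cases o <;> simp [forestPart]

theorem mem_vertexSet {o : Option (DoublyRootedTree V)} {a : V} :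
    a ∈ vertexSet o ↔ ∃ E, o = some E ∧ a ∈ E.tree.verts := by
  cases o <;> simp [vertexSet]

theorem stem_adj {w : V} {o : Option (DoublyRootedTree V)} {a b : V} :
    (stem w o).Adj a b ↔ ∃ E, o = some E ∧ s(w, E.r1) = s(a, b) ∧ a ≠ b := by
  cases o <;> simp [stem, SimpleGraph.adj_edge]

theorem forestPart_adj_mem {o : Option (DoublyRootedTree V)} {a b : V}
    (h : (forestPart o).Adj a b) : a ∈ vertexSet o ∧ b ∈ vertexSet o := by
  obtain ⟨E, rfl, h⟩ := forestPart_adj.1 h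
  exact ⟨h.fst_mem, h.snd_mem⟩

theorem stem_adj_mem {w : V} {o : Option (DoublyRootedTree V)} {a b : V}
    (h : (stem w o).Adj a b) : a = w ∧ b ∈ vertexSet o ∨ b = w ∧ a ∈ vertexSet o := by
  obtain ⟨E, rfl, h, _⟩ := stem_adj.1 h
  rcases Sym2.eq_iff.1 h with ⟨rfl, rfl⟩ | ⟨rfl, rfl⟩
  · exact .inl ⟨rfl, E.r1_mem⟩
  · exact .inr ⟨rfl, E.r1_mem⟩

/-- No edge of K leaves the vertex set of the hanging tree, so the new edge joins two different
components of K. -/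
theorem isAcyclic_sup_stem {K : SimpleGraph V} {w : V} {o : Option (DoublyRootedTree V)}
    (hK : K.IsAcyclic) (hcl : ∀ a b, K.Adj a b → a ∈ vertexSet o → b ∈ vertexSet o)
    (hw : w ∉ vertexSet o) : (K ⊔ stem w o).IsAcyclic := by
  cases o with
  | none => simpa [stem] using hK
  | some E =>
    exact hK.sup_edge_of_not_reachable fun h => hw (reachable_mem hcl h.symm E.r1_mem)

/-- In the graph `G` rooted at the first root of `D`, the branch `o` lies below the second root
of `D`: the ancestors of the end of `o` are ancestors of that root or belong to `o`. -/
structure HangsBelow (G : SimpleGraph V) (D : DoublyRootedTree V)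
    (o : Option (DoublyRootedTree V)) : Prop where
  isAncestor : IsAncestor G D.r1 D.r2 (endRoot D.r2 o)
  isAncestor_or_mem : ∀ u, IsAncestor G D.r1 u (endRoot D.r2 o) →
    IsAncestor G D.r1 u D.r2 ∨ u ∈ vertexSet o
  isChild : ∀ E, o = some E →
    IsChild G D.r1 E.r1 D.r2 ∧ IsAncestor G D.r1 E.r1 (endRoot D.r2 o)

/-- For nonempty E, the path of D from root to root, the stem and the path of E from root to root
form a path by disjointness; in a tree it is the only one, so its vertices are all the ancestors of
its end. -/
theorem hangsBelow_of_hang_le {G : SimpleGraph V} (hG : G.IsTree) {D : DoublyRootedTree V}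
    {o : Option (DoublyRootedTree V)} (hD : D.tree.spanningCoe ≤ G) (ho : hang D.r2 o ≤ G)
    (hdis : Disjoint D.tree.verts (vertexSet o)) : HangsBelow G D o := by
  cases o with
  | none =>
    exact ⟨isAncestor_refl hG _ _, fun u hu => .inl hu, fun E h => by cases h⟩
  | some E =>
    have hdis' : ∀ x ∈ D.tree.verts, x ∉ E.tree.verts := fun _ hx => Set.disjoint_left.1 hdis hx
    have hne : D.r2 ≠ E.r1 := fun h => hdis' _ D.r2_mem (h ▸ E.r1_mem)
    have hadj : G.Adj D.r2 E.r1 := ho (by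
      rw [hang]; exact .inr ((SimpleGraph.edge_adj ..).2 ⟨.inl ⟨rfl, rfl⟩, hne⟩))
    obtain ⟨p, hp, hpD⟩ := D.exists_path D.r1_mem D.r2_mem hD
    obtain ⟨p', hp', hpE⟩ := E.exists_path E.r1_mem E.r2_mem
      (le_trans (by rw [hang]; exact le_sup_left) ho)
    have hsupp : (p.append (.cons hadj p')).support = p.support ++ p'.support := by
      rw [SimpleGraph.Walk.support_append, SimpleGraph.Walk.support_cons, List.tail_cons]
    have hpath : (p.append (.cons hadj p')).IsPath := by
      rw [SimpleGraph.Walk.isPath_def, hsupp, List.nodup_append']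
      exact ⟨hp.support_nodup, hp'.support_nodup,
        fun x hx hx' => hdis' x (hpD x hx) (hpE x hx')⟩
    refine ⟨⟨_, hpath, hsupp ▸ List.mem_append_left _ p.end_mem_support⟩, fun u hu => ?_, ?_⟩
    · have hu' := (isAncestor_iff hG.isAcyclic hpath).1 hu
      rw [hsupp, List.mem_append] at hu'
      exact hu'.imp (fun h => ⟨p, hp, h⟩) (fun h => hpE u h)
    · rintro _ ⟨⟩
      exact ⟨⟨⟨p.concat hadj, hp.concat (fun h => hdis' _ (hpD _ h) E.r1_mem) hadj, by simp⟩,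
        hadj⟩, ⟨_, hpath, hsupp ▸ List.mem_append_right _ p'.start_mem_support⟩⟩

namespace TreeTriple

variable (q : TreeTriple V)

/-- The union of the three trees of a triple. -/
def forest : SimpleGraph V := q.D.tree.spanningCoe ⊔ forestPart q.D' ⊔ forestPart q.D''

/-- The graph that arises by merging the three trees of a triple. -/
def mergeGraph : SimpleGraph V :=
  q.D.tree.spanningCoe ⊔ hang q.D.r2 q.D' ⊔ hang q.D.r2 q.D''

theorem mergeGraph_eq : q.mergeGraph = q.forest ⊔ stem q.D.r2 q.D' ⊔ stem q.D.r2 q.D'' := by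
  rw [mergeGraph, forest, hang_eq, hang_eq]
  ac_rfl

theorem forest_le : q.forest ≤ q.mergeGraph := by
  rw [mergeGraph_eq, sup_assoc]; exact le_sup_left

variable {q}

theorem forest_adj {a b : V} : q.forest.Adj a b ↔
    q.D.tree.Adj a b ∨ (forestPart q.D').Adj a b ∨ (forestPart q.D'').Adj a b := by
  simp [forest, or_assoc]

theorem not_mem_left {a : V} (h : a ∈ q.D.tree.verts) : a ∉ vertexSet q.D' :=
  Set.disjoint_left.1 q.comp.1 h

theorem not_mem_right {a : V} (h : a ∈ q.D.tree.verts) : a ∉ vertexSet q.D'' :=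
  Set.disjoint_left.1 q.comp.2.1 h

theorem not_mem_both {a : V} (h : a ∈ vertexSet q.D') : a ∉ vertexSet q.D'' :=
  Set.disjoint_left.1 q.comp.2.2.1 h

theorem mem_cases (q : TreeTriple V) (a : V) :
    a ∈ q.D.tree.verts ∨ a ∈ vertexSet q.D' ∨ a ∈ vertexSet q.D'' := by
  have : a ∈ q.D.tree.verts ∪ vertexSet q.D' ∪ vertexSet q.D'' := q.comp.2.2.2 ▸ Set.mem_univ a
  simpa [or_assoc] using this

theorem isComponentOf_forest (q : TreeTriple V) : IsComponentOf q.forest q.D := by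
  refine isComponentOf_of_closed (by rw [forest, sup_assoc]; exact le_sup_left) ?_
  intro a b hab ha
  rcases forest_adj.1 hab with h | h | h
  · exact h
  · exact absurd (forestPart_adj_mem h).1 (not_mem_left ha)
  · exact absurd (forestPart_adj_mem h).1 (not_mem_right ha)

theorem isComponentOf_forest_left {E : DoublyRootedTree V} (hE : q.D' = some E) :
    IsComponentOf q.forest E := by
  have hv : ∀ a, a ∈ E.tree.verts → a ∈ vertexSet q.D' := fun a h => hE ▸ h
  refine isComponentOf_of_closed (fun a b hab => forest_adj.2 (.inr (.inl ?_))) ?_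
  · exact forestPart_adj.2 ⟨E, hE, hab⟩
  intro a b hab ha
  rcases forest_adj.1 hab with h | h | h
  · exact absurd (hv a ha) (not_mem_left h.fst_mem)
  · obtain ⟨F, hF, h⟩ := forestPart_adj.1 h
    obtain rfl : E = F := Option.some_injective _ (hE.symm.trans hF)
    exact h
  · exact absurd (forestPart_adj_mem h).1 (not_mem_both (hv a ha))

theorem isComponentOf_forest_right {E : DoublyRootedTree V} (hE : q.D'' = some E) :
    IsComponentOf q.forest E := by
  have hv : ∀ a, a ∈ E.tree.verts → a ∈ vertexSet q.D'' := fun a h => hE ▸ h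
  refine isComponentOf_of_closed (fun a b hab => forest_adj.2 (.inr (.inr ?_))) ?_
  · exact forestPart_adj.2 ⟨E, hE, hab⟩
  intro a b hab ha
  rcases forest_adj.1 hab with h | h | h
  · exact absurd (hv a ha) (not_mem_right h.fst_mem)
  · exact absurd (hv a ha) (not_mem_both (forestPart_adj_mem h).1)
  · obtain ⟨F, hF, h⟩ := forestPart_adj.1 h
    obtain rfl : E = F := Option.some_injective _ (hE.symm.trans hF)
    exact h

theorem isAcyclic_forest (q : TreeTriple V) : q.forest.IsAcyclic := by
  intro v c
  rcases q.mem_cases v with h | h | h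
  · exact q.isComponentOf_forest.not_isCycle h c
  · obtain ⟨E, hE, h⟩ := mem_vertexSet.1 h
    exact (isComponentOf_forest_left hE).not_isCycle h c
  · obtain ⟨E, hE, h⟩ := mem_vertexSet.1 h
    exact (isComponentOf_forest_right hE).not_isCycle h c

theorem isTree_mergeGraph (q : TreeTriple V) : q.mergeGraph.IsTree := by
  have hw := q.D.r2_mem
  have hl : ∀ a b, q.forest.Adj a b → a ∈ vertexSet q.D' → b ∈ vertexSet q.D' := by
    intro a b hab ha
    obtain ⟨E, hE, ha⟩ := mem_vertexSet.1 ha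
    exact mem_vertexSet.2 ⟨E, hE, (isComponentOf_forest_left hE).mem_of_adj hab ha⟩
  have hr : ∀ a b, q.forest.Adj a b → a ∈ vertexSet q.D'' → b ∈ vertexSet q.D'' := by
    intro a b hab ha
    obtain ⟨E, hE, ha⟩ := mem_vertexSet.1 ha
    exact mem_vertexSet.2 ⟨E, hE, (isComponentOf_forest_right hE).mem_of_adj hab ha⟩
  have hreach : ∀ v, q.mergeGraph.Reachable q.D.r2 v := by
    have hstem : ∀ {o} {E : DoublyRootedTree V}, o = some E →
        Disjoint q.D.tree.verts (vertexSet o) → stem q.D.r2 o ≤ q.mergeGraph →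
        IsComponentOf q.forest E → ∀ v ∈ E.tree.verts, q.mergeGraph.Reachable q.D.r2 v := by
      rintro _ E rfl hdis hle hE v hv
      have hne : q.D.r2 ≠ E.r1 := fun h => Set.disjoint_left.1 hdis hw (h ▸ E.r1_mem)
      have hadj : q.mergeGraph.Adj q.D.r2 E.r1 := hle (stem_adj.2 ⟨E, rfl, rfl, hne⟩)
      exact hadj.reachable.trans ((hE.reachable E.r1_mem hv).mono q.forest_le)
    intro v
    rcases q.mem_cases v with h | h | h
    · exact (q.isComponentOf_forest.reachable hw h).mono q.forest_le
    · obtain ⟨E, hE, h⟩ := mem_vertexSet.1 h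
      exact hstem hE q.comp.1 (by rw [mergeGraph_eq]; exact le_sup_right.trans le_sup_left)
        (isComponentOf_forest_left hE) v h
    · obtain ⟨E, hE, h⟩ := mem_vertexSet.1 h
      exact hstem hE q.comp.2.1 (by rw [mergeGraph_eq]; exact le_sup_right)
        (isComponentOf_forest_right hE) v h
  refine ⟨{ preconnected := fun a b => (hreach a).symm.trans (hreach b),
            nonempty := ⟨q.D.r2⟩ }, ?_⟩
  rw [mergeGraph_eq]
  refine isAcyclic_sup_stem (isAcyclic_sup_stem q.isAcyclic_forest hl (not_mem_left hw)) ?_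
    (not_mem_right hw)
  rintro a b (hab | hab) ha
  · exact hr a b hab ha
  · rcases stem_adj_mem hab with ⟨rfl, _⟩ | ⟨_, h⟩
    · exact absurd ha (not_mem_right hw)
    · exact absurd ha (not_mem_both h)

/-- The triply rooted tree that arises by merging a triple. -/
def merge (q : TreeTriple V) : TriplyRootedTree V where
  graph := q.mergeGraph
  isTree := q.isTree_mergeGraph
  r1 := q.D.r1
  r2 := endRoot q.D.r2 q.D'
  r3 := endRoot q.D.r2 q.D''

theorem isMerge_merge (q : TreeTriple V) : IsMerge q q.merge := ⟨rfl, rfl, rfl, rfl⟩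

theorem hangsBelow_left (q : TreeTriple V) : HangsBelow q.mergeGraph q.D q.D' :=
  hangsBelow_of_hang_le q.isTree_mergeGraph
    (by rw [mergeGraph, sup_assoc]; exact le_sup_left)
    (by rw [mergeGraph]; exact le_sup_right.trans le_sup_left) q.comp.1

theorem hangsBelow_right (q : TreeTriple V) : HangsBelow q.mergeGraph q.D q.D'' :=
  hangsBelow_of_hang_le q.isTree_mergeGraph
    (by rw [mergeGraph, sup_assoc]; exact le_sup_left)
    (by rw [mergeGraph]; exact le_sup_right) q.comp.2.1

/-- A common ancestor that is not an ancestor of r₂(D) would lie in both D' and D''. -/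
theorem isLCA_merge (q : TreeTriple V) :
    IsLCA q.merge.graph q.merge.r1 q.merge.r2 q.merge.r3 q.D.r2 := by
  obtain ⟨hl, hl', _⟩ := q.hangsBelow_left
  obtain ⟨hr, hr', _⟩ := q.hangsBelow_right
  refine ⟨hl, hr, fun u hu hu' => ?_⟩
  rcases hl' u hu with h | h
  · exact h.dist_le q.isTree_mergeGraph
  rcases hr' u hu' with h' | h'
  · exact h'.dist_le q.isTree_mergeGraph
  · exact absurd h' (not_mem_both h)

theorem cutGraph_merge (q : TreeTriple V) : cutGraph q.merge q.D.r2 = q.forest := by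
  obtain ⟨_, hl, hl'⟩ := q.hangsBelow_left
  obtain ⟨_, hr, hr'⟩ := q.hangsBelow_right
  have hT := q.isTree_mergeGraph
  ext a b
  rw [cutGraph, SimpleGraph.deleteEdges_adj]
  constructor
  · rintro ⟨hab, hnot⟩
    have hab' : q.mergeGraph.Adj a b := hab
    rw [mergeGraph_eq] at hab'
    rcases hab' with (h | h) | h
    · exact h
    · obtain ⟨E, hE, h, _⟩ := stem_adj.1 h
      exact absurd ⟨E.r1, (hl' E hE).1, .inl (hl' E hE).2, h.symm⟩ hnot
    · obtain ⟨E, hE, h, _⟩ := stem_adj.1 h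
      exact absurd ⟨E.r1, (hr' E hE).1, .inr (hr' E hE).2, h.symm⟩ hnot
  -- A child of r₂(D) on the way to the second or third root lies in D' or D'', whereas the
  -- neighbours of r₂(D) in the forest lie in D; so no forest edge is cut.
  · intro hab
    refine ⟨q.forest_le hab, ?_⟩
    rintro ⟨x, hx, hanc, he⟩
    have hx' : x ∈ vertexSet q.D' ∨ x ∈ vertexSet q.D'' := by
      rcases hanc with h | h
      · exact .inl ((hl x h).resolve_left (hx.not_isAncestor hT))
      · exact .inr ((hr x h).resolve_left (hx.not_isAncestor hT))
    have hwx : q.forest.Adj q.D.r2 x := by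
      rw [← SimpleGraph.mem_edgeSet, ← he]; exact hab
    have hxD := q.isComponentOf_forest.mem_of_adj hwx q.D.r2_mem
    rcases hx' with h | h
    · exact not_mem_left hxD h
    · exact not_mem_right hxD h

theorem isSplit_merge (q : TreeTriple V) : IsSplit q.merge q.D.r2 q := by
  have branch : ∀ (o : Option (DoublyRootedTree V)), Disjoint q.D.tree.verts (vertexSet o) →
      (∀ E, o = some E → IsChild q.mergeGraph q.D.r1 E.r1 q.D.r2 ∧
        IsAncestor q.mergeGraph q.D.r1 E.r1 (endRoot q.D.r2 o)) →
      (∀ E, o = some E → IsComponentOf q.forest E) →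
      IsBranch q.merge q.D.r2 (endRoot q.D.r2 o) o := by
    intro o hdis h1 h2
    cases o with
    | none => exact .inl ⟨rfl, rfl⟩
    | some E =>
      refine .inr ⟨fun h => ?_, E, rfl, (h1 E rfl).1, (h1 E rfl).2, rfl, ?_⟩
      · have h' : q.D.r2 = E.r2 := h
        exact Set.disjoint_left.1 hdis q.D.r2_mem (h' ▸ E.r2_mem)
      · rw [cutGraph_merge]; exact h2 E rfl
  refine ⟨rfl, rfl, ?_, ?_, ?_⟩
  · rw [cutGraph_merge]; exact q.isComponentOf_forest
  · exact branch _ q.comp.1 q.hangsBelow_left.isChild fun E => isComponentOf_forest_left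
  · exact branch _ q.comp.2.1 q.hangsBelow_right.isChild fun E => isComponentOf_forest_right

end TreeTriple

end Merge

/-! ### Splitting an arbitrary triply rooted tree -/

section Split

variable {V : Type*} {t : TriplyRootedTree V} {w : V}

theorem cutGraph_le : cutGraph t w ≤ t.graph := SimpleGraph.deleteEdges_le _

theorem IsBranch.of_child {s x : V} {o : Option (DoublyRootedTree V)} (h : IsBranch t w s o)
    (hx : IsChild t.graph t.r1 x w) (hxs : IsAncestor t.graph t.r1 x s) :
    ∃ F, o = some F ∧ F.r1 = x ∧ IsComponentOf (cutGraph t w) F := by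
  rcases h with ⟨rfl, _⟩ | ⟨_, F, rfl, hc, ha, _, hF⟩
  · exact absurd hxs (hx.not_isAncestor t.isTree)
  · exact ⟨F, rfl, hc.unique t.isTree hx ha hxs, hF⟩

theorem IsBranch.unique {s : V} {o o' : Option (DoublyRootedTree V)} (h : IsBranch t w s o)
    (h' : IsBranch t w s o') : o = o' := by
  rcases h with ⟨rfl, rfl⟩ | ⟨hne, F, rfl, hc, ha, h2, hF⟩
  · rcases h' with ⟨_, rfl⟩ | ⟨hne, _⟩
    · rfl
    · exact absurd rfl hne
  · rcases h' with ⟨rfl, _⟩ | ⟨_, F', rfl, hc', ha', h2', hF'⟩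
    · exact absurd rfl hne
    · rw [hF.eq hF' (hc.unique t.isTree hc' ha ha') (h2.trans h2'.symm)]

theorem IsSplit.unique {q q' : TreeTriple V} (h : IsSplit t w q) (h' : IsSplit t w q') :
    q = q' :=
  TreeTriple.ext (h.2.2.1.eq h'.2.2.1 (h.1.trans h'.1.symm) (h.2.1.trans h'.2.1.symm))
    (h.2.2.2.1.unique h'.2.2.2.1) (h.2.2.2.2.unique h'.2.2.2.2)

theorem merge_injective : Function.Injective (TreeTriple.merge (V := V)) := by
  intro q q' h
  have hq := q.isSplit_merge
  have hw := q.isLCA_merge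
  rw [h] at hq hw
  rw [hw.unique q'.isTree_mergeGraph q'.isLCA_merge |>.symm] at hq
  exact hq.unique q'.isSplit_merge

theorem cutGraph_adj_or {a b : V} (h : t.graph.Adj a b) : (cutGraph t w).Adj a b ∨
    ∃ x, IsChild t.graph t.r1 x w ∧ (IsAncestor t.graph t.r1 x t.r2 ∨
      IsAncestor t.graph t.r1 x t.r3) ∧ s(a, b) = s(w, x) := by
  by_cases h' : ∃ x, IsChild t.graph t.r1 x w ∧ (IsAncestor t.graph t.r1 x t.r2 ∨
      IsAncestor t.graph t.r1 x t.r3) ∧ s(a, b) = s(w, x)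
  · exact .inr h'
  · exact .inl (SimpleGraph.deleteEdges_adj.2 ⟨h, h'⟩)

/-- A cut edge on the path from the root to w would make a child of w an ancestor of w. -/
theorem cutGraph_reachable_root (t : TriplyRootedTree V) (w : V) :
    (cutGraph t w).Reachable t.r1 w := by
  obtain ⟨p, hp, _⟩ := t.isTree.existsUnique_path t.r1 w
  refine ⟨p.toDeleteEdges _ ?_⟩
  rintro _ he ⟨x, hx, _, rfl⟩
  exact hx.not_isAncestor t.isTree ⟨p, hp, p.snd_mem_support_of_mem_edges he⟩

theorem cutGraph_reachable_of_notMem {x s : V} (p : t.graph.Walk x s) (hp : w ∉ p.support) :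
    (cutGraph t w).Reachable x s := by
  refine ⟨p.toDeleteEdges _ ?_⟩
  rintro _ he ⟨x, hx, _, rfl⟩
  exact hp (p.fst_mem_support_of_mem_edges he)

theorem not_reachable_deleteEdges {x : V} (h : t.graph.Adj w x) :
    ¬ (t.graph.deleteEdges {s(w, x)}).Reachable w x :=
  SimpleGraph.isBridge_iff.1 (SimpleGraph.isAcyclic_iff_forall_isBridge.1 t.isTree.isAcyclic h)

/-- The vertex `x` is a child of `w` on the way to the second or the third root. -/
def IsCutChild (t : TriplyRootedTree V) (w x : V) : Prop :=
  IsChild t.graph t.r1 x w ∧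
    (IsAncestor t.graph t.r1 x t.r2 ∨ IsAncestor t.graph t.r1 x t.r3)

theorem IsCutChild.cutGraph_le {x : V} (h : IsCutChild t w x) :
    cutGraph t w ≤ t.graph.deleteEdges {s(w, x)} :=
  SimpleGraph.deleteEdges_anti (by rintro _ rfl; exact ⟨x, h.1, h.2, rfl⟩)

theorem IsCutChild.not_reachable {x : V} (h : IsCutChild t w x) :
    ¬ (cutGraph t w).Reachable w x :=
  fun h' => not_reachable_deleteEdges h.1.2 (h'.mono h.cutGraph_le)

/-- Otherwise the edge from w to y followed by a walk from y to x would bypass the bridge between w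
and x. -/
theorem IsCutChild.not_reachable_of_ne {x y : V} (hx : IsCutChild t w x) (hy : IsCutChild t w y)
    (hne : x ≠ y) : ¬ (cutGraph t w).Reachable x y := by
  intro h
  refine not_reachable_deleteEdges hx.1.2 (SimpleGraph.Reachable.trans ?_
    (h.symm.mono hx.cutGraph_le))
  refine SimpleGraph.Adj.reachable (SimpleGraph.deleteEdges_adj.2 ⟨hy.1.2, ?_⟩)
  rw [Set.mem_singleton_iff, Sym2.congr_right]
  exact hne.symm

theorem exists_isBranch {s : V} (h : IsAncestor t.graph t.r1 w s) :
    ∃ o, IsBranch t w s o := by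
  by_cases hne : w = s
  · exact ⟨none, .inl ⟨hne, rfl⟩⟩
  · obtain ⟨x, hx, hxs, p, hp⟩ := h.exists_child hne
    obtain ⟨F, h1, h2, hF⟩ := exists_component (t.isTree.isAcyclic.anti cutGraph_le)
      (cutGraph_reachable_of_notMem p hp)
    exact ⟨some F, .inr ⟨hne, F, rfl, h1 ▸ hx, h1 ▸ hxs, h2, hF⟩⟩

theorem IsBranch.of_some {s : V} {F : DoublyRootedTree V} (h : IsBranch t w s (some F)) :
    IsChild t.graph t.r1 F.r1 w ∧ IsAncestor t.graph t.r1 F.r1 s ∧ F.r2 = s ∧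
      IsComponentOf (cutGraph t w) F := by
  rcases h with ⟨_, h⟩ | ⟨_, F', hF', h⟩
  · cases h
  · obtain rfl := Option.some_injective _ hF'
    exact h

theorem IsBranch.endRoot_eq {s : V} {o : Option (DoublyRootedTree V)} (h : IsBranch t w s o) :
    endRoot w o = s := by
  cases o with
  | none =>
    rcases h with ⟨h, _⟩ | ⟨_, F, h, _⟩
    · exact h
    · cases h
  | some F => exact h.of_some.2.2.1

theorem exists_isSplit (hw : IsLCA t.graph t.r1 t.r2 t.r3 w) : ∃ q, IsSplit t w q := by
  obtain ⟨D, h1, h2, hD⟩ := exists_component (t.isTree.isAcyclic.anti cutGraph_le)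
    (cutGraph_reachable_root t w)
  obtain ⟨o, ho⟩ := exists_isBranch hw.1
  obtain ⟨o', ho'⟩ := exists_isBranch hw.2.1
  have hwD : w ∈ D.tree.verts := h2 ▸ D.r2_mem
  have hcut : ∀ {F}, o = some F → IsCutChild t w F.r1 := by
    rintro F rfl; exact ⟨ho.of_some.1, .inl ho.of_some.2.1⟩
  have hcut' : ∀ {F}, o' = some F → IsCutChild t w F.r1 := by
    rintro F rfl; exact ⟨ho'.of_some.1, .inr ho'.of_some.2.1⟩
  have hcomp : ∀ {F}, o = some F → IsComponentOf (cutGraph t w) F := by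
    rintro F rfl; exact ho.of_some.2.2.2
  have hcomp' : ∀ {F}, o' = some F → IsComponentOf (cutGraph t w) F := by
    rintro F rfl; exact ho'.of_some.2.2.2
  refine ⟨⟨D, o, o', ?_, ?_, ?_, ?_⟩, h1, h2, hD, ho, ho'⟩
  · rw [Set.disjoint_left]
    intro v hv hv'
    obtain ⟨F, hF, hv'⟩ := mem_vertexSet.1 hv'
    exact Set.disjoint_left.1 (hD.disjoint (hcomp hF) hwD F.r1_mem
      (hcut hF).not_reachable) hv hv'
  · rw [Set.disjoint_left]
    intro v hv hv'
    obtain ⟨F, hF, hv'⟩ := mem_vertexSet.1 hv'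
    exact Set.disjoint_left.1 (hD.disjoint (hcomp' hF) hwD F.r1_mem
      (hcut' hF).not_reachable) hv hv'
  · rw [Set.disjoint_left]
    intro v hv hv'
    obtain ⟨F, hF, hv⟩ := mem_vertexSet.1 hv
    obtain ⟨F', hF', hv'⟩ := mem_vertexSet.1 hv'
    refine Set.disjoint_left.1 ((hcomp hF).disjoint (hcomp' hF') F.r1_mem F'.r1_mem
      ((hcut hF).not_reachable_of_ne (hcut' hF') ?_)) hv hv'
    -- A common first vertex of both branches would be a common ancestor one level below w.
    intro heq
    subst hF hF'
    have := hw.2.2 F.r1 ho.of_some.2.1 (heq ▸ ho'.of_some.2.1)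
    rw [ho.of_some.1.dist_eq t.isTree] at this
    omega
  -- The union of the pieces contains w and is closed under adjacency in t: uncut edges stay within
  -- a piece, and both ends of a cut edge belong to pieces.
  · refine Set.eq_univ_of_forall fun v => reachable_mem (G := t.graph) ?_
      (t.isTree.connected w v) (.inl (.inl hwD))
    intro a b hab ha
    rcases cutGraph_adj_or (w := w) hab with h | ⟨x, hx, hanc, he⟩
    · rcases ha with (ha | ha) | ha
      · exact .inl (.inl (hD.mem_of_adj h ha))
      · obtain ⟨F, hF, ha⟩ := mem_vertexSet.1 ha
        exact .inl (.inr (mem_vertexSet.2 ⟨F, hF, (hcomp hF).mem_of_adj h ha⟩))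
      · obtain ⟨F, hF, ha⟩ := mem_vertexSet.1 ha
        exact .inr (mem_vertexSet.2 ⟨F, hF, (hcomp' hF).mem_of_adj h ha⟩)
    · rcases Sym2.eq_iff.1 he with ⟨_, rfl⟩ | ⟨_, rfl⟩
      · rcases hanc with hanc | hanc
        · obtain ⟨F, hF, rfl, _⟩ := ho.of_child hx hanc
          exact .inl (.inr (mem_vertexSet.2 ⟨F, hF, F.r1_mem⟩))
        · obtain ⟨F, hF, rfl, _⟩ := ho'.of_child hx hanc
          exact .inr (mem_vertexSet.2 ⟨F, hF, F.r1_mem⟩)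
      · exact .inl (.inl hwD)

theorem IsSplit.merge_eq {q : TreeTriple V} (h : IsSplit t w q) : q.merge = t := by
  obtain ⟨h1, h2, hD, hl, hr⟩ := h
  have hcomp : ∀ {F}, q.D' = some F → IsComponentOf (cutGraph t w) F := by
    intro F hF; rw [hF] at hl; exact hl.of_some.2.2.2
  have hcomp' : ∀ {F}, q.D'' = some F → IsComponentOf (cutGraph t w) F := by
    intro F hF; rw [hF] at hr; exact hr.of_some.2.2.2
  have hstem : ∀ {s o}, IsBranch t w s o → stem w o ≤ t.graph := by
    intro s o ho a b hab
    obtain ⟨F, rfl, he, _⟩ := stem_adj.1 hab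
    rw [← SimpleGraph.mem_edgeSet, ← he]
    exact ho.of_some.1.2
  refine TriplyRootedTree.ext (le_antisymm ?_ ?_) h1
    ((congrArg (endRoot · _) h2).trans hl.endRoot_eq)
    ((congrArg (endRoot · _) h2).trans hr.endRoot_eq)
  · change q.mergeGraph ≤ t.graph
    rw [TreeTriple.mergeGraph_eq, h2]
    refine sup_le (sup_le (le_trans ?_ (cutGraph_le (w := w))) (hstem hl)) (hstem hr)
    intro a b hab
    rcases TreeTriple.forest_adj.1 hab with h | h | h
    · exact hD.le h
    · obtain ⟨F, hF, h⟩ := forestPart_adj.1 h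
      exact (hcomp hF).le h
    · obtain ⟨F, hF, h⟩ := forestPart_adj.1 h
      exact (hcomp' hF).le h
  · change t.graph ≤ q.mergeGraph
    rw [TreeTriple.mergeGraph_eq, h2]
    intro a b hab
    rcases cutGraph_adj_or (w := w) hab with h | ⟨x, hx, hanc, he⟩
    · refine .inl (.inl (TreeTriple.forest_adj.2 ?_))
      rcases q.mem_cases a with ha | ha | ha
      · exact .inl (hD.adj h ha)
      · obtain ⟨F, hF, ha⟩ := mem_vertexSet.1 ha
        exact .inr (.inl (forestPart_adj.2 ⟨F, hF, (hcomp hF).adj h ha⟩))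
      · obtain ⟨F, hF, ha⟩ := mem_vertexSet.1 ha
        exact .inr (.inr (forestPart_adj.2 ⟨F, hF, (hcomp' hF).adj h ha⟩))
    · rcases hanc with hanc | hanc
      · obtain ⟨F, hF, rfl, _⟩ := hl.of_child hx hanc
        exact .inl (.inr (stem_adj.2 ⟨F, hF, he.symm, hab.ne⟩))
      · obtain ⟨F, hF, rfl, _⟩ := hr.of_child hx hanc
        exact .inr (stem_adj.2 ⟨F, hF, he.symm, hab.ne⟩)

theorem merge_bijective [Finite V] : Function.Bijective (TreeTriple.merge (V := V)) := by
  refine ⟨merge_injective, fun t => ?_⟩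
  obtain ⟨w, hw⟩ := exists_isLCA t.isTree t.r1 t.r2 t.r3
  obtain ⟨q, hq⟩ := exists_isSplit hw
  exact ⟨q, hq.merge_eq⟩

end Split

end TriplyRooted

theorem theorem1 (n : ℕ) (hn : 1 ≤ n) :
    (∃ φ : TriplyRooted.Q n ≃ TriplyRooted.T n,
      (∀ q, TriplyRooted.IsMerge q (φ q)) ∧
      (∀ t, ∃ w, TriplyRooted.IsLCA t.graph t.r1 t.r2 t.r3 w ∧
        (∀ w', TriplyRooted.IsLCA t.graph t.r1 t.r2 t.r3 w' → w' = w) ∧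
        TriplyRooted.IsSplit t w (φ.symm t))) ∧
    Nat.card (TriplyRooted.Q n) = TriplyRooted.tripleSum n ∧
    Nat.card (TriplyRooted.T n) = n ^ (n + 1) ∧
    TriplyRooted.tripleSum n = n ^ (n + 1) ∧
    (n : ℝ) ^ n * (TriplyRooted.xi₂ n - TriplyRooted.xi n) = (TriplyRooted.tripleSum n : ℝ) ∧
    (TriplyRooted.tripleSum n = n ^ (n + 1) ↔
      TriplyRooted.xi₂ n = TriplyRooted.xi n + n) ∧
    TriplyRooted.xi₂ n = TriplyRooted.xi n + n := by
  have : Nonempty (Fin n) := ⟨⟨0, hn⟩⟩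
  let φ : TriplyRooted.Q n ≃ TriplyRooted.T n :=
    Equiv.ofBijective TriplyRooted.TreeTriple.merge TriplyRooted.merge_bijective
  have hQ : Nat.card (TriplyRooted.Q n) = TriplyRooted.tripleSum n := by
    simpa using TriplyRooted.card_treeTriple (Fin n)
  have hT : Nat.card (TriplyRooted.T n) = n ^ (n + 1) := by
    simpa using TriplyRooted.card_triplyRootedTree (Fin n)
  have hS : TriplyRooted.tripleSum n = n ^ (n + 1) := by
    rw [← hQ, ← hT, Nat.card_congr φ]
  refine ⟨⟨φ, TriplyRooted.TreeTriple.isMerge_merge, fun t => ?_⟩, hQ, hT, hS,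
    TriplyRooted.pow_mul_xi₂_sub_xi n hn, TriplyRooted.lacasse_iff n hn,
    (TriplyRooted.lacasse_iff n hn).1 hS⟩
  -- Every triply rooted tree is a merge, so the description of the inverse need only be checked on
  -- merges.
  obtain ⟨q, rfl⟩ := φ.surjective t
  rw [φ.symm_apply_apply]
  exact ⟨q.D.r2, q.isLCA_merge, fun w' hw' => q.isLCA_merge.unique q.isTree_mergeGraph hw',
    q.isSplit_merge⟩
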